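/- Let $N$ be a Gaussian white noise on $\mathbb{R}$ with variance $\sigma^2$, regarded as a generalized random process, i.e. an almost surely linear family of random variables $\langle N,\varphi\rangle$, $\varphi\in\mathcal S(\mathbb R)$ (the pairing is the distributional one, linear in $\varphi$). In the real case this means that for all real $\varphi\in\mathcal S(\mathbb R)$ $$\mathbb E\, e^{i\langle N,\varphi\rangle}=e^{-\sigma^2\|\varphi\|_{L^2}^2/2},$$ and in the complex case, with relation $\rho\in\mathbb C$ (so that $\mathbb E|\langle N,\varphi\rangle|^2=\sigma^2\|\varphi\|^2_{L^2}$ and $\mathbb E\langle N,\varphi\rangle^2=\rho\int\varphi^2$; the circular case is $\rho=0$), that for all complex $\varphi\in\mathcal S(\mathbb R)$ $$\mathbb E\, e^{i\,\mathrm{Re}\langle N,\varphi\rangle}=e^{-\left(\sigma^2\|\varphi\|_{L^2}^2+\mathrm{Re}\left(\rho\int\varphi^2\right)\right)/4}.$$ Let $\gamma:\mathbb R\to\mathbb R$ be a monotonically increasing $C^2$ function with $\gamma'(t)>0$ for almost every $t$, and let $[D_\gamma x](t)=\sqrt{\gamma'(t)}\,x(\gamma(t))$. Define the warped process $D_\gamma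 N$ by duality, $\langle D_\gamma N,\varphi\rangle=\langle N,D_\gamma^{T}\varphi\rangle$ for $\varphi\in\mathcal S(\mathbb R)$, where $D_\gamma^{T}\varphi\in L^2(\mathbb R)$ is determined by $\int (D_\gamma x)\,\varphi=\int x\,(D_\gamma^{T}\varphi)$ for all $x\in\mathcal S(\mathbb R)$ (it equals $D_\gamma^{-1}\varphi$ when $D_\gamma$ is unitary on $L^2(\mathbb R)$), and where $\langle N,g\rangle$ for $g\in L^2(\mathbb R)$ is the limit in probability of $\langle N,\psi\rangle$ as $\psi\in\mathcal S(\mathbb R)$ tends to $g$ in $L^2(\mathbb R)$. Then $D_\gamma N$ exists, and (every version of) it is again a Gaussian white noise with the same variance: if $N$ is a real Gaussian white noise with variance $\sigma^2$, so is $D_\gamma N$; if $N$ is a complex Gaussian white noise with variance $\sigma^2$ and relation $\rho$, so is $D_\gamma N$ (in particular circularity is preserved). -/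

import Mathlib

open MeasureTheory Filter Topology
open scoped SchwartzMap

/-- The time warping operator on functions, `[D_γ x](t) = √(γ'(t)) x(γ(t))`. -/
noncomputable def timeWarp {𝕜 : Type*} [RCLike 𝕜] (γ : ℝ → ℝ) (x : ℝ → 𝕜) : ℝ → 𝕜 :=
  fun t => ((√(deriv γ t) : ℝ) : 𝕜) * x (γ t)

/-- A generalized random process (random linear functional) on the Schwartz space: `N φ` is the
random variable `⟨N, φ⟩`, and `φ ↦ ⟨N, φ⟩` is almost surely linear. The pairing is the
distributional one, linear in `φ` (formally `⟨N, φ⟩ = ∫ N(t) φ(t) dt`). Continuity in `φ` is not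
listed: for the white noises below it follows from the characteristic functional. -/
structure IsRandomFunctional {Ω : Type*} [MeasurableSpace Ω] (P : Measure Ω)
    {𝕜 : Type*} [RCLike 𝕜] (N : 𝓢(ℝ, 𝕜) → Ω → 𝕜) : Prop where
  aemeasurable : ∀ φ, AEMeasurable (N φ) P
  map_add : ∀ φ ψ, N (φ + ψ) =ᵐ[P] N φ + N ψ
  map_smul : ∀ (c : 𝕜) φ, N (c • φ) =ᵐ[P] c • N φ

/-- Real Gaussian white noise of variance `σ²`: the characteristic functional is
`E exp(i ⟨N, φ⟩) = exp(-σ² ‖φ‖² / 2)`. -/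
structure IsRealGaussianWhiteNoise {Ω : Type*} [MeasurableSpace Ω] (P : Measure Ω)
    (N : 𝓢(ℝ, ℝ) → Ω → ℝ) (σ : ℝ) : Prop extends IsRandomFunctional P N where
  charFunctional : ∀ φ : 𝓢(ℝ, ℝ),
    ∫ ω, Complex.exp (Complex.I * (N φ ω : ℂ)) ∂P
      = ((Real.exp (-(σ ^ 2 * ∫ t, φ t ^ 2) / 2) : ℝ) : ℂ)

/-- Complex Gaussian white noise of variance `σ²` and relation `ρ`, that is, centered Gaussian with
`E |⟨N, φ⟩|² = σ² ‖φ‖²` and `E ⟨N, φ⟩² = ρ ∫ φ²`; it is circular when `ρ = 0`. As the real part of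
`⟨N, φ⟩` then has variance `(σ² ‖φ‖² + Re (ρ ∫ φ²)) / 2`, its characteristic functional is
`E exp(i Re ⟨N, φ⟩) = exp(-(σ² ‖φ‖² + Re (ρ ∫ φ²)) / 4)`. Since `φ` ranges over complex test
functions and `N` is complex linear, this determines all joint laws of real and imaginary parts. -/
structure IsComplexGaussianWhiteNoise {Ω : Type*} [MeasurableSpace Ω] (P : Measure Ω)
    (N : 𝓢(ℝ, ℂ) → Ω → ℂ) (σ : ℝ) (ρ : ℂ) : Prop extends IsRandomFunctional P N where
  charFunctional : ∀ φ : 𝓢(ℝ, ℂ),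
    ∫ ω, Complex.exp (Complex.I * ((N φ ω).re : ℂ)) ∂P
      = ((Real.exp (-(σ ^ 2 * (∫ t, ‖φ t‖ ^ 2) + (ρ * ∫ t, φ t ^ 2).re) / 4) : ℝ) : ℂ)

/-- `g ∈ L²(ℝ)` is the transpose of `D_γ` applied to `φ`:
`∫ (D_γ x)(t) φ(t) dt = ∫ x(t) g(t) dt` for all test functions `x`.
It is unique almost everywhere. When `D_γ` is unitary, it is `D_γ⁻¹ φ`. -/
def IsWarpTranspose {𝕜 : Type*} [RCLike 𝕜] (γ : ℝ → ℝ) (φ : 𝓢(ℝ, 𝕜)) (g : ℝ → 𝕜) : Prop :=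
  MemLp g 2 volume ∧
    ∀ x : 𝓢(ℝ, 𝕜), ∫ t, timeWarp γ (fun s => x s) t * φ t = ∫ t, x t * g t

/-- The random variable `X` is the pairing `⟨N, g⟩` of `N` with `g ∈ L²(ℝ)`, defined by continuity:
`⟨N, ψ⟩ → X` in probability as the test function `ψ` tends to `g` in `L²(ℝ)`. -/
def IsL2Pairing {Ω : Type*} [MeasurableSpace Ω] (P : Measure Ω) {𝕜 : Type*} [RCLike 𝕜]
    (N : 𝓢(ℝ, 𝕜) → Ω → 𝕜) (g : ℝ → 𝕜) (X : Ω → 𝕜) : Prop :=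
  TendstoInMeasure P N
    (comap (fun ψ : 𝓢(ℝ, 𝕜) => eLpNorm (fun t => ψ t - g t) 2 volume) (𝓝 0)) X

/-- `M` is (a version of) the warped generalized process `D_γ N`, defined by duality:
`⟨D_γ N, φ⟩ = ⟨N, D_γᵀ φ⟩` for every test function `φ`. -/
def IsWarpedProcess {Ω : Type*} [MeasurableSpace Ω] (P : Measure Ω) {𝕜 : Type*} [RCLike 𝕜]
    (γ : ℝ → ℝ) (N M : 𝓢(ℝ, 𝕜) → Ω → 𝕜) : Prop :=
  ∀ φ : 𝓢(ℝ, 𝕜), ∃ g : ℝ → 𝕜, IsWarpTranspose γ φ g ∧ IsL2Pairing P N g (M φ)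

/-!
The transpose of the warping operator is explicit: `D_γᵀ φ` takes the value `φ t / √(γ' t)` at
`γ t` and vanishes off the range of `γ`. The change of variables `s = γ t` shows that it preserves
both `‖φ‖²` and the bilinear integral `∫ φ²` (`noiseForm_warpTranspose`). The characteristic
functional of a white noise depends on the test function only through these two quantities, so
warping leaves it unchanged, once the pairing `⟨N, g⟩` is available for `g ∈ L²(ℝ)`.

For that, the characteristic functional along the line through `φ` shows that the real and imaginary
parts of `⟨N, φ⟩` are centered Gaussian with variances controlled by `‖φ‖²`. Hence `N` is bounded
from `L²(ℝ)` to `L²(P)` (`IsGaussianFunctional.exists_eLpNorm_le`), and as test functions are dense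
in `L²(ℝ)` and `L²(P)` is complete, the limit in probability defining `⟨N, g⟩` exists
(`IsGaussianFunctional.exists_isL2Pairing`). Almost sure linearity and the formula for the
characteristic functional pass to the limit along almost surely convergent sequences.

The transpose is unique almost everywhere (`IsWarpTranspose.ae_eq`), so every version of the warped
process is obtained from the explicit one. Real and complex noises are treated together over
`RCLike 𝕜` (`IsGaussianFunctional`).
-/

/-! ### Approximation of square-integrable functions by test functions -/

section Approximation

variable {𝕜 : Type*} [RCLike 𝕜]

/-- The filter of test functions `ψ` tending to `g` in `L²(ℝ)`. -/
noncomputable abbrev testFunctionsTendingTo (g : ℝ → 𝕜) : Filter 𝓢(ℝ, 𝕜) :=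
  comap (fun ψ : 𝓢(ℝ, 𝕜) => eLpNorm (fun t => ψ t - g t) 2 volume) (𝓝 0)

theorem neBot_testFunctionsTendingTo {g : ℝ → 𝕜} (hg : MemLp g 2 volume) :
    (testFunctionsTendingTo g).NeBot := by
  rw [testFunctionsTendingTo, comap_neBot_iff]
  intro s hs
  obtain ⟨ε, hε, hεs⟩ := ENNReal.nhds_zero_basis_Iic.mem_iff.1 hs
  obtain ⟨δ, -, hδ, hδε⟩ := ENNReal.lt_iff_exists_real_btwn.1 hε
  have hδ' : 0 < δ := by simpa using hδ
  obtain ⟨f, hf₁, hf₂, hf₃⟩ :=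
    hg.exist_eLpNorm_sub_le (by simp : (2 : ENNReal) ≠ ⊤) (by norm_num) hδ'
  refine ⟨hf₁.toSchwartzMap hf₂, hεs ?_⟩
  have h : (fun t => (hf₁.toSchwartzMap hf₂) t - g t) = f - g := rfl
  rw [Set.mem_Iic, h, eLpNorm_sub_comm]
  exact hf₃.trans hδε.le

theorem tendsto_eLpNorm_testFunctions (g : ℝ → 𝕜) :
    Tendsto (fun ψ : 𝓢(ℝ, 𝕜) => eLpNorm (⇑ψ - g) 2 volume) (testFunctionsTendingTo g) (𝓝 0) :=
  tendsto_comap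

/-- Limits in `L²` may be taken inside the bilinear integral `∫ f h`. -/
theorem tendsto_integral_mul_of_tendsto_eLpNorm {ι : Type*} {l : Filter ι}
    {u v : ι → ℝ → 𝕜} {f h : ℝ → 𝕜} (hu : ∀ i, MemLp (u i) 2 volume)
    (hv : ∀ i, MemLp (v i) 2 volume) (hf : MemLp f 2 volume) (hh : MemLp h 2 volume)
    (huf : Tendsto (fun i => eLpNorm (u i - f) 2 volume) l (𝓝 0))
    (hvh : Tendsto (fun i => eLpNorm (v i - h) 2 volume) l (𝓝 0)) :
    Tendsto (fun i => ∫ t, u i t * v i t) l (𝓝 (∫ t, f t * h t)) := by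
  have key : ∀ {a b : ℝ → 𝕜} (ha : MemLp a 2 volume) (hb : MemLp b 2 volume),
      ∫ t, a t * b t = inner 𝕜 (ha.star.toLp (star a)) (hb.toLp b) := by
    intro a b ha hb
    rw [L2.inner_def]
    refine integral_congr_ae ?_
    filter_upwards [ha.star.coeFn_toLp, hb.coeFn_toLp] with t h₁ h₂
    rw [h₁, h₂, RCLike.inner_apply]
    simp [mul_comm]
  simp_rw [key (hu _) (hv _), key hf hh]
  refine Tendsto.inner ?_ ((Lp.tendsto_Lp_iff_tendsto_eLpNorm'' _ hv _ hh).2 hvh)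
  refine (Lp.tendsto_Lp_iff_tendsto_eLpNorm'' _ (fun i => (hu i).star) _ hf.star).2 ?_
  refine huf.congr fun i => ?_
  rw [← star_sub, eLpNorm_star]

theorem integral_norm_sq_eq_re_integral_mul_star (f : ℝ → 𝕜) :
    ∫ t, ‖f t‖ ^ 2 = RCLike.re (∫ t, f t * star (f t)) := by
  have h : ∀ t, f t * star (f t) = ((‖f t‖ ^ 2 : ℝ) : 𝕜) := fun t => by
    simpa using RCLike.mul_conj (f t)
  simp_rw [h]
  rw [integral_ofReal, RCLike.ofReal_re]

end Approximation

/-! ### Gaussian functionals -/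

section Gaussian

variable {Ω : Type*} [MeasurableSpace Ω] {P : Measure Ω} {𝕜 : Type*} [RCLike 𝕜]

/-- The quadratic form `a ‖f‖² + Re (ρ ∫ f²)`: the characteristic functional of a white noise is the
exponential of its negative. -/
noncomputable def noiseForm (a : ℝ) (ρ : 𝕜) (f : ℝ → 𝕜) : ℝ :=
  a * (∫ t, ‖f t‖ ^ 2) + RCLike.re (ρ * ∫ t, f t ^ 2)

/-- A random functional over `𝕜 = ℝ` or `ℂ` with characteristic functional
`E exp(i Re ⟨N, φ⟩) = exp(-(a ‖φ‖² + Re (ρ ∫ φ²)))`. The real white noise is the case `a = σ² / 2`,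
`ρ = 0` over `ℝ`, and the complex one is the case `a = σ² / 4`, with `ρ / 4` as `ρ`, over `ℂ`. -/
structure IsGaussianFunctional (P : Measure Ω) (N : 𝓢(ℝ, 𝕜) → Ω → 𝕜) (a : ℝ) (ρ : 𝕜) : Prop
    extends IsRandomFunctional P N where
  charFunctional : ∀ φ : 𝓢(ℝ, 𝕜),
    ∫ ω, Complex.exp (Complex.I * (RCLike.re (N φ ω) : ℝ)) ∂P
      = ((Real.exp (-noiseForm a ρ φ) : ℝ) : ℂ)

theorem noiseForm_const_mul_real (a : ℝ) (ρ : 𝕜) (f : ℝ → 𝕜) (s : ℝ) :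
    noiseForm a ρ (fun t => (s : 𝕜) * f t) = s ^ 2 * noiseForm a ρ f := by
  have h : ρ * ((s : 𝕜) ^ 2 * ∫ t, f t ^ 2) = ((s ^ 2 : ℝ) : 𝕜) * (ρ * ∫ t, f t ^ 2) := by
    push_cast; ring
  simp only [noiseForm, norm_mul, mul_pow, integral_const_mul, RCLike.norm_ofReal, sq_abs]
  rw [h, RCLike.re_ofReal_mul]
  ring

theorem noiseForm_le (a : ℝ) (ρ : 𝕜) (f : ℝ → 𝕜) :
    noiseForm a ρ f ≤ (|a| + ‖ρ‖) * ∫ t, ‖f t‖ ^ 2 := by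
  have h₀ : 0 ≤ ∫ t, ‖f t‖ ^ 2 := integral_nonneg fun t => by positivity
  have h₁ : ‖∫ t, f t ^ 2‖ ≤ ∫ t, ‖f t‖ ^ 2 := by
    refine (norm_integral_le_integral_norm _).trans_eq ?_
    simp only [norm_pow]
  have h₂ : RCLike.re (ρ * ∫ t, f t ^ 2) ≤ ‖ρ‖ * ∫ t, ‖f t‖ ^ 2 :=
    (RCLike.re_le_norm _).trans (by rw [norm_mul]; gcongr)
  have h₃ : a * ∫ t, ‖f t‖ ^ 2 ≤ |a| * ∫ t, ‖f t‖ ^ 2 := by gcongr; exact le_abs_self a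
  rw [noiseForm, add_mul]
  exact add_le_add h₃ h₂

/-- The quadratic form is continuous in `L²`. -/
theorem tendsto_noiseForm (a : ℝ) (ρ : 𝕜) {g : ℝ → 𝕜} (hg : MemLp g 2 volume) :
    Tendsto (fun ψ : 𝓢(ℝ, 𝕜) => noiseForm a ρ ψ) (testFunctionsTendingTo g)
      (𝓝 (noiseForm a ρ g)) := by
  have hψ : ∀ ψ : 𝓢(ℝ, 𝕜), MemLp ψ 2 volume := fun ψ => ψ.memLp 2 volume
  have hlim := tendsto_eLpNorm_testFunctions g
  have hstar : Tendsto (fun ψ : 𝓢(ℝ, 𝕜) => eLpNorm (star ⇑ψ - star g) 2 volume)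
      (testFunctionsTendingTo g) (𝓝 0) :=
    hlim.congr fun ψ => by rw [← star_sub, eLpNorm_star]
  have h₁ := tendsto_integral_mul_of_tendsto_eLpNorm hψ (fun ψ => (hψ ψ).star) hg hg.star
    hlim hstar
  have h₂ := tendsto_integral_mul_of_tendsto_eLpNorm hψ hψ hg hg hlim hlim
  simp only [noiseForm, integral_norm_sq_eq_re_integral_mul_star, pow_two (_ : 𝕜)]
  exact (((RCLike.continuous_re.tendsto _).comp h₁).const_mul a).add
    ((RCLike.continuous_re.tendsto _).comp (h₂.const_mul ρ))

/-- A real random variable with characteristic function `exp(-v s²)` is centered Gaussian with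
variance `2v`, and in particular `v` is nonnegative. -/
theorem memLp_two_and_integral_sq_of_charFun [IsProbabilityMeasure P] {X : Ω → ℝ}
    (hX : AEMeasurable X P) {v : ℝ}
    (h : ∀ s : ℝ, ∫ ω, Complex.exp (Complex.I * ((s * X ω : ℝ) : ℂ)) ∂P
      = ((Real.exp (-(s ^ 2 * v)) : ℝ) : ℂ)) :
    MemLp X 2 P ∧ ∫ ω, X ω ^ 2 ∂P = 2 * v := by
  have hv : 0 ≤ v := by
    have h1 : ‖∫ ω, Complex.exp (Complex.I * (((1 : ℝ) * X ω : ℝ) : ℂ)) ∂P‖ ≤ 1 * P.real Set.univ :=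
      norm_integral_le_of_norm_le_const (ae_of_all _ fun ω => by
        rw [mul_comm, Complex.norm_exp_ofReal_mul_I])
    rw [h 1, Complex.norm_real, Real.norm_eq_abs, Real.abs_exp] at h1
    simpa using h1
  have hlaw : P.map X = ProbabilityTheory.gaussianReal 0 (2 * v).toNNReal := by
    have := Measure.isProbabilityMeasure_map hX
    refine Measure.ext_of_charFun (funext fun s => ?_)
    rw [ProbabilityTheory.charFun_gaussianReal, charFun_apply_real,
      integral_map hX (by fun_prop)]
    have h2 := h s
    simp only [Complex.ofReal_mul, mul_comm Complex.I] at h2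
    rw [h2, Complex.ofReal_exp]
    congr 1
    rw [Real.coe_toNNReal _ (by positivity)]
    push_cast
    ring
  have hid : MemLp id 2 (P.map X) := by
    rw [hlaw]; exact ProbabilityTheory.memLp_id_gaussianReal' 2 (by simp)
  refine ⟨hid.comp_of_map hX, ?_⟩
  have h3 : ∫ x, x ^ 2 ∂(P.map X) = 2 * v := by
    have h4 := ProbabilityTheory.variance_eq_sub
      (ProbabilityTheory.memLp_id_gaussianReal' (μ := 0) (v := (2 * v).toNNReal) 2 (by simp))
    rw [ProbabilityTheory.variance_id_gaussianReal] at h4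
    simp only [id, ProbabilityTheory.integral_id_gaussianReal, Pi.pow_apply] at h4
    rw [hlaw, ← sub_zero (∫ x, x ^ 2 ∂_)]
    simpa [hv] using h4.symm
  rw [← h3, integral_map hX (by fun_prop)]

namespace IsGaussianFunctional

variable {N : 𝓢(ℝ, 𝕜) → Ω → 𝕜} {a : ℝ} {ρ : 𝕜}

theorem memLp_two_re_and_integral_sq [IsProbabilityMeasure P] (hN : IsGaussianFunctional P N a ρ)
    (φ : 𝓢(ℝ, 𝕜)) :
    MemLp (fun ω => RCLike.re (N φ ω)) 2 P ∧
      ∫ ω, RCLike.re (N φ ω) ^ 2 ∂P = 2 * noiseForm a ρ φ := by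
  refine memLp_two_and_integral_sq_of_charFun (RCLike.measurable_re.comp_aemeasurable
    (hN.aemeasurable φ)) fun s => ?_
  have h := hN.charFunctional ((s : 𝕜) • φ)
  rw [show ⇑((s : 𝕜) • φ) = fun t => (s : 𝕜) * φ t from rfl, noiseForm_const_mul_real] at h
  rw [← h]
  refine integral_congr_ae ?_
  filter_upwards [hN.map_smul (s : 𝕜) φ] with ω hω
  rw [hω, Pi.smul_apply, smul_eq_mul, RCLike.re_ofReal_mul, Function.comp_apply]

/-- A white noise is bounded from `L²(ℝ)` to `L²(P)`. The real part and the imaginary part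
`Im ⟨N, φ⟩ = Re ⟨N, -iφ⟩` are both centered Gaussian, with variances controlled by `‖φ‖²`. -/
theorem exists_eLpNorm_le [IsProbabilityMeasure P] (hN : IsGaussianFunctional P N a ρ) :
    ∃ C : NNReal, ∀ φ : 𝓢(ℝ, 𝕜), MemLp (N φ) 2 P ∧
      eLpNorm (N φ) 2 P ≤ C * eLpNorm φ 2 volume := by
  set K : ℝ := 4 * (|a| + ‖ρ‖) with hK
  have hK0 : 0 ≤ K := by positivity
  refine ⟨(√K).toNNReal, fun φ => ?_⟩
  obtain ⟨hr, hr2⟩ := hN.memLp_two_re_and_integral_sq φ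
  obtain ⟨hi, hi2⟩ := hN.memLp_two_re_and_integral_sq ((-RCLike.I : 𝕜) • φ)
  -- in the real case `I = 0`, and this reads `0 = 0`
  have him : (fun ω => RCLike.re (N ((-RCLike.I : 𝕜) • φ) ω)) =ᵐ[P]
      fun ω => RCLike.im (N φ ω) := by
    filter_upwards [hN.map_smul (-RCLike.I : 𝕜) φ] with ω hω
    rw [hω, Pi.smul_apply, smul_eq_mul, neg_mul, map_neg, RCLike.I_mul_re, neg_neg]
  have him' : MemLp (fun ω => RCLike.im (N φ ω)) 2 P := hi.ae_eq him
  have hmem : MemLp (N φ) 2 P := memLp_re_im_iff.1 ⟨hr, him'⟩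
  have hIφ : ∫ t, ‖((-RCLike.I : 𝕜) • φ) t‖ ^ 2 ≤ ∫ t, ‖φ t‖ ^ 2 := by
    refine integral_mono
      ((memLp_two_iff_integrable_sq_norm (by fun_prop)).1 (((-RCLike.I : 𝕜) • φ).memLp 2 volume))
      ((memLp_two_iff_integrable_sq_norm (by fun_prop)).1 (φ.memLp 2 volume)) fun t => ?_
    have hI : ‖(RCLike.I : 𝕜)‖ ≤ 1 := by
      rcases RCLike.I_mul_I (K := 𝕜) with h | h
      · simp [h]
      · have := congrArg norm h
        rw [norm_mul, norm_neg, norm_one] at this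
        nlinarith [norm_nonneg (RCLike.I : 𝕜)]
    have : ‖((-RCLike.I : 𝕜) • φ) t‖ ≤ ‖φ t‖ := by
      rw [smul_apply, norm_smul, norm_neg]
      exact mul_le_of_le_one_left (norm_nonneg _) hI
    dsimp only
    gcongr
  have hint : ∫ ω, ‖N φ ω‖ ^ 2 ∂P ≤ K * ∫ t, ‖φ t‖ ^ 2 := by
    have him2 : ∫ ω, RCLike.im (N φ ω) ^ 2 ∂P = 2 * noiseForm a ρ ⇑((-RCLike.I : 𝕜) • φ) := by
      rw [← hi2]
      refine integral_congr_ae ?_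
      filter_upwards [him] with ω hω
      rw [hω]
    have hsum : ∫ ω, ‖N φ ω‖ ^ 2 ∂P
        = ∫ ω, RCLike.re (N φ ω) ^ 2 ∂P + ∫ ω, RCLike.im (N φ ω) ^ 2 ∂P := by
      rw [← integral_add hr.integrable_sq him'.integrable_sq]
      refine integral_congr_ae (ae_of_all _ fun ω => ?_)
      dsimp only
      rw [RCLike.norm_sq_eq_def, pow_two, pow_two]
    rw [hsum, hr2, him2]
    have h₁ := noiseForm_le a ρ φ
    have h₂ := (noiseForm_le a ρ ⇑((-RCLike.I : 𝕜) • φ)).trans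
      (mul_le_mul_of_nonneg_left hIφ (by positivity : 0 ≤ |a| + ‖ρ‖))
    rw [hK]
    linarith
  refine ⟨hmem, ?_⟩
  rw [hmem.eLpNorm_eq_integral_rpow_norm (by simp) (by simp),
    (φ.memLp 2 volume).eLpNorm_eq_integral_rpow_norm (by simp) (by simp)]
  simp only [ENNReal.toReal_ofNat, Real.rpow_ofNat, ← one_div, ← Real.sqrt_eq_rpow]
  change _ ≤ ENNReal.ofReal (√K) * _
  rw [← ENNReal.ofReal_mul (Real.sqrt_nonneg _), ← Real.sqrt_mul hK0]
  exact ENNReal.ofReal_le_ofReal (Real.sqrt_le_sqrt hint)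

end IsGaussianFunctional

end Gaussian

/-! ### Pairing with square-integrable functions -/

section Pairing

variable {Ω : Type*} [MeasurableSpace Ω] {P : Measure Ω} {𝕜 : Type*} [RCLike 𝕜]
  {N : 𝓢(ℝ, 𝕜) → Ω → 𝕜} {a : ℝ} {ρ : 𝕜}

theorem IsRandomFunctional.map_sub (hN : IsRandomFunctional P N) (φ ψ : 𝓢(ℝ, 𝕜)) :
    N (φ - ψ) =ᵐ[P] N φ - N ψ := by
  have h := hN.map_add (φ - ψ) ψ
  rw [sub_add_cancel] at h
  filter_upwards [h] with ω hω
  simp [hω]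

theorem IsL2Pairing.congr_ae {g g' : ℝ → 𝕜} {X : Ω → 𝕜} (h : IsL2Pairing P N g X)
    (hg : g =ᵐ[volume] g') : IsL2Pairing P N g' X := by
  have : (fun ψ : 𝓢(ℝ, 𝕜) => eLpNorm (fun t => ψ t - g t) 2 volume)
      = fun ψ : 𝓢(ℝ, 𝕜) => eLpNorm (fun t => ψ t - g' t) 2 volume := by
    funext ψ
    refine eLpNorm_congr_ae ?_
    filter_upwards [hg] with t ht
    rw [ht]
  unfold IsL2Pairing at h ⊢
  rwa [← this]

/-- By the bound from `L²(ℝ)` to `L²(P)`, the image under `N` of the filter of test functions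
tending to `g` is a Cauchy filter in the complete space `L²(P)`. -/
theorem IsGaussianFunctional.exists_isL2Pairing [IsProbabilityMeasure P]
    (hN : IsGaussianFunctional P N a ρ) {g : ℝ → 𝕜} (hg : MemLp g 2 volume) :
    ∃ X, IsL2Pairing P N g X := by
  obtain ⟨C, hC⟩ := hN.exists_eLpNorm_le
  have := neBot_testFunctionsTendingTo hg
  set l := testFunctionsTendingTo g with hl
  let T : 𝓢(ℝ, 𝕜) → Lp 𝕜 2 P := fun φ => (hC φ).1.toLp (N φ)
  have hcauchy : Cauchy (map T l) := by
    refine cauchy_map_iff.2 ⟨this, tendsto_uniformity_iff_dist_tendsto_zero.2 ?_⟩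
    have hlim := tendsto_eLpNorm_testFunctions g
    have hsum : Tendsto (fun p : 𝓢(ℝ, 𝕜) × 𝓢(ℝ, 𝕜) =>
        (C : ENNReal) * (eLpNorm (⇑p.1 - g) 2 volume + eLpNorm (⇑p.2 - g) 2 volume))
        (l ×ˢ l) (𝓝 0) := by
      have h := ENNReal.Tendsto.const_mul (a := (C : ENNReal))
        ((hlim.comp tendsto_fst).add (hlim.comp (tendsto_snd (f := l))))
        (Or.inr ENNReal.coe_ne_top)
      simpa using h
    have hle : ∀ p : 𝓢(ℝ, 𝕜) × 𝓢(ℝ, 𝕜), edist (T p.1) (T p.2)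
        ≤ C * (eLpNorm (⇑p.1 - g) 2 volume + eLpNorm (⇑p.2 - g) 2 volume) := by
      rintro ⟨φ, ψ⟩
      rw [Lp.edist_toLp_toLp, ← eLpNorm_congr_ae (hN.map_sub φ ψ)]
      refine (hC _).2.trans ?_
      gcongr
      have h : ⇑(φ - ψ) = (⇑φ - g) - (⇑ψ - g) := by
        funext t; simp
      rw [h]
      exact eLpNorm_sub_le (φ.continuous.aestronglyMeasurable.sub hg.1)
        (ψ.continuous.aestronglyMeasurable.sub hg.1) (by norm_num)
    have hz := tendsto_of_tendsto_of_tendsto_of_le_of_le tendsto_const_nhds hsum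
      (fun _ => zero_le) hle
    have := (ENNReal.tendsto_toReal ENNReal.zero_ne_top).comp hz
    simpa [dist_edist, Function.comp_def] using this
  obtain ⟨Y, hY⟩ := CompleteSpace.complete hcauchy
  exact ⟨Y, (tendstoInMeasure_of_tendsto_Lp hY).congr_left fun φ => (hC φ).1.coeFn_toLp⟩

/-- Any pairing is an almost sure limit of pairings with test functions. -/
theorem IsL2Pairing.exists_seq {g : ℝ → 𝕜} (hg : MemLp g 2 volume) {X : Ω → 𝕜}
    (h : IsL2Pairing P N g X) :
    ∃ ψ : ℕ → 𝓢(ℝ, 𝕜), Tendsto ψ atTop (testFunctionsTendingTo g) ∧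
      ∀ᵐ ω ∂P, Tendsto (fun n => N (ψ n) ω) atTop (𝓝 (X ω)) := by
  have := neBot_testFunctionsTendingTo hg
  exact h.exists_seq_tendsto_ae'

theorem IsL2Pairing.aemeasurable (hN : IsRandomFunctional P N) {g : ℝ → 𝕜}
    (hg : MemLp g 2 volume) {X : Ω → 𝕜} (h : IsL2Pairing P N g X) : AEMeasurable X P := by
  have := neBot_testFunctionsTendingTo hg
  exact TendstoInMeasure.aemeasurable hN.aemeasurable h

/-- The value of a pairing is determined by any one approximating sequence. -/
theorem IsL2Pairing.ae_eq_of_tendsto {g : ℝ → 𝕜} {X Y : Ω → 𝕜} (h : IsL2Pairing P N g X)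
    {ψ : ℕ → 𝓢(ℝ, 𝕜)} (hψ : Tendsto ψ atTop (testFunctionsTendingTo g))
    (hY : ∀ᵐ ω ∂P, Tendsto (fun n => N (ψ n) ω) atTop (𝓝 (Y ω))) : X =ᵐ[P] Y := by
  obtain ⟨ns, hns, hX⟩ := (TendstoInMeasure.comp h hψ).exists_seq_tendsto_ae
  filter_upwards [hX, hY] with ω h₁ h₂
  exact tendsto_nhds_unique h₁ (h₂.comp hns.tendsto_atTop)

theorem IsL2Pairing.add (hN : IsRandomFunctional P N) {f g : ℝ → 𝕜} (hf : MemLp f 2 volume)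
    (hg : MemLp g 2 volume) {X Y Z : Ω → 𝕜} (hX : IsL2Pairing P N f X) (hY : IsL2Pairing P N g Y)
    (hZ : IsL2Pairing P N (f + g) Z) : Z =ᵐ[P] X + Y := by
  obtain ⟨φ, hφ, hφX⟩ := hX.exists_seq hf
  obtain ⟨ψ, hψ, hψY⟩ := hY.exists_seq hg
  refine hZ.ae_eq_of_tendsto (ψ := fun n => φ n + ψ n) (tendsto_comap_iff.2 ?_) ?_
  · have hsum := (tendsto_comap_iff.1 hφ).add (tendsto_comap_iff.1 hψ)
    rw [add_zero] at hsum
    refine tendsto_of_tendsto_of_tendsto_of_le_of_le tendsto_const_nhds hsum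
      (fun _ => zero_le) fun n => ?_
    have h : (fun t => (φ n + ψ n) t - (f + g) t)
        = (fun t => φ n t - f t) + fun t => ψ n t - g t := by
      funext t; simp; ring
    simp only [Function.comp_apply, h]
    exact eLpNorm_add_le ((φ n).continuous.aestronglyMeasurable.sub hf.1)
      ((ψ n).continuous.aestronglyMeasurable.sub hg.1) (by norm_num)
  · filter_upwards [hφX, hψY, ae_all_iff.2 fun n => hN.map_add (φ n) (ψ n)] with ω h₁ h₂ h₃
    exact (h₁.add h₂).congr fun n => (h₃ n).symm

theorem IsL2Pairing.smul (hN : IsRandomFunctional P N) {f : ℝ → 𝕜} (hf : MemLp f 2 volume) (c : 𝕜)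
    {X Z : Ω → 𝕜} (hX : IsL2Pairing P N f X) (hZ : IsL2Pairing P N (c • f) Z) :
    Z =ᵐ[P] c • X := by
  obtain ⟨φ, hφ, hφX⟩ := hX.exists_seq hf
  refine hZ.ae_eq_of_tendsto (ψ := fun n => c • φ n) (tendsto_comap_iff.2 ?_) ?_
  · have hmul := ENNReal.Tendsto.const_mul (a := ‖c‖ₑ) (tendsto_comap_iff.1 hφ)
      (Or.inr enorm_ne_top)
    rw [mul_zero] at hmul
    refine hmul.congr fun n => ?_
    have h : (fun t => (c • φ n) t - (c • f) t) = c • fun t => φ n t - f t := by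
      funext t; simp [mul_sub]
    simp only [Function.comp_apply, h]
    rw [eLpNorm_const_smul]
  · filter_upwards [hφX, ae_all_iff.2 fun n => hN.map_smul c (φ n)] with ω h₁ h₂
    exact (h₁.const_smul c).congr fun n => (h₂ n).symm

/-- The formula for the characteristic functional extends to `L²(ℝ)` by dominated convergence. -/
theorem IsGaussianFunctional.integral_exp_of_isL2Pairing [IsProbabilityMeasure P]
    (hN : IsGaussianFunctional P N a ρ) {g : ℝ → 𝕜} (hg : MemLp g 2 volume) {X : Ω → 𝕜}
    (h : IsL2Pairing P N g X) :
    ∫ ω, Complex.exp (Complex.I * (RCLike.re (X ω) : ℝ)) ∂P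
      = ((Real.exp (-noiseForm a ρ g) : ℝ) : ℂ) := by
  obtain ⟨ψ, hψ, hψX⟩ := h.exists_seq hg
  have hleft : Tendsto (fun n => ∫ ω, Complex.exp (Complex.I * (RCLike.re (N (ψ n) ω) : ℝ)) ∂P)
      atTop (𝓝 (∫ ω, Complex.exp (Complex.I * (RCLike.re (X ω) : ℝ)) ∂P)) := by
    refine tendsto_integral_of_dominated_convergence (fun _ => 1) (fun n => ?_)
      (integrable_const _) (fun n => ae_of_all _ fun ω => ?_) ?_
    · have hm : Measurable fun z : 𝕜 => Complex.exp (Complex.I * (RCLike.re z : ℝ)) := by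
        fun_prop
      exact (hm.comp_aemeasurable (hN.aemeasurable (ψ n))).aestronglyMeasurable
    · rw [mul_comm, Complex.norm_exp_ofReal_mul_I]
    · filter_upwards [hψX] with ω hω
      have hc : Continuous fun z : 𝕜 => Complex.exp (Complex.I * (RCLike.re z : ℝ)) := by
        fun_prop
      exact (hc.tendsto _).comp hω
  have hright := (tendsto_noiseForm a ρ hg).comp hψ
  simp only [hN.charFunctional] at hleft
  refine tendsto_nhds_unique hleft ?_
  exact (Complex.continuous_ofReal.tendsto _).comp
    ((Real.continuous_exp.tendsto _).comp hright.neg)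

end Pairing

/-! ### The transpose of the warping operator -/

section Warp

variable {𝕜 : Type*} [RCLike 𝕜] {γ : ℝ → ℝ}

theorem strictMono_of_monotone_of_ae_deriv_pos (hmono : Monotone γ)
    (hpos : ∀ᵐ t : ℝ, 0 < deriv γ t) : StrictMono γ := by
  refine hmono.strictMono_of_injective fun x y hxy => ?_
  by_contra hne
  wlog hlt : x < y generalizing x y
  · exact this y x hxy.symm (Ne.symm hne) (lt_of_le_of_ne (not_lt.1 hlt) (Ne.symm hne))
  -- between two points with the same value the monotone function is constant
  have hzero : ∀ t ∈ Set.Ioo x y, deriv γ t = 0 := by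
    intro t ht
    have : γ =ᶠ[𝓝 t] fun _ => γ x := by
      filter_upwards [isOpen_Ioo.mem_nhds ht] with s hs
      exact le_antisymm (hxy ▸ hmono hs.2.le) (hmono hs.1.le)
    rw [this.deriv_eq, deriv_const]
  have hnull : volume (Set.Ioo x y) = 0 :=
    measure_mono_null (fun t ht => by simp [hzero t ht]) (ae_iff.1 hpos)
  rw [Real.volume_Ioo, ENNReal.ofReal_eq_zero] at hnull
  linarith

/-- The transpose of the warping operator `D_γ` for injective `γ`: at `γ t` its value is
`φ t / √(γ' t)`, and it vanishes off the range of `γ`, which need not be the whole line. -/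
noncomputable def warpTranspose (γ : ℝ → ℝ) (φ : ℝ → 𝕜) : ℝ → 𝕜 :=
  Function.extend γ (fun t => φ t / ((√(deriv γ t) : ℝ) : 𝕜)) 0

theorem warpTranspose_apply (hinj : Function.Injective γ) (φ : ℝ → 𝕜) (t : ℝ) :
    warpTranspose γ φ (γ t) = φ t / ((√(deriv γ t) : ℝ) : 𝕜) :=
  hinj.extend_apply _ _ _

theorem warpTranspose_of_notMem_range {s : ℝ} (hs : s ∉ Set.range γ) (φ : ℝ → 𝕜) :
    warpTranspose γ φ s = 0 :=
  Function.extend_apply' _ _ _ hs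

theorem warpTranspose_add (hinj : Function.Injective γ) (φ ψ : ℝ → 𝕜) :
    warpTranspose γ (φ + ψ) = warpTranspose γ φ + warpTranspose γ ψ := by
  funext s
  by_cases hs : s ∈ Set.range γ
  · obtain ⟨t, rfl⟩ := hs
    simp [warpTranspose_apply hinj, add_div]
  · simp [warpTranspose_of_notMem_range hs]

theorem warpTranspose_smul (hinj : Function.Injective γ) (c : 𝕜) (φ : ℝ → 𝕜) :
    warpTranspose γ (c • φ) = c • warpTranspose γ φ := by
  funext s
  by_cases hs : s ∈ Set.range γ
  · obtain ⟨t, rfl⟩ := hs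
    simp [warpTranspose_apply hinj, mul_div_assoc]
  · simp [warpTranspose_of_notMem_range hs]

theorem measurable_warpTranspose (hcont : Continuous γ) (hinj : Function.Injective γ) {φ : ℝ → 𝕜}
    (hφ : Measurable φ) : Measurable (warpTranspose γ φ) :=
  (hcont.measurableEmbedding hinj).measurable_extend
    (hφ.div (by have := measurable_deriv γ; fun_prop)) measurable_zero

/-- Change of variables `s = γ t` for functions that vanish off the range of `γ`. -/
theorem integral_eq_integral_deriv_smul_comp {E : Type*} [NormedAddCommGroup E] [NormedSpace ℝ E]
    (hdiff : Differentiable ℝ γ) (hmono : Monotone γ) (hinj : Function.Injective γ) {h : ℝ → E}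
    (hh : ∀ s ∉ Set.range γ, h s = 0) : ∫ s, h s = ∫ t, deriv γ t • h (γ t) := by
  have key := integral_image_eq_integral_abs_deriv_smul MeasurableSet.univ
    (fun x _ => (hdiff x).hasDerivAt.hasDerivWithinAt) hinj.injOn h
  rw [Set.image_univ, setIntegral_univ] at key
  rw [← setIntegral_eq_integral_of_forall_compl_eq_zero hh, key]
  simp only [abs_of_nonneg hmono.deriv_nonneg]

theorem lintegral_eq_lintegral_deriv_mul_comp
    (hdiff : Differentiable ℝ γ) (hmono : Monotone γ) (hinj : Function.Injective γ)
    {h : ℝ → ENNReal} (hh : ∀ s ∉ Set.range γ, h s = 0) :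
    ∫⁻ s, h s = ∫⁻ t, ENNReal.ofReal (deriv γ t) * h (γ t) := by
  have key := lintegral_image_eq_lintegral_abs_deriv_mul MeasurableSet.univ
    (fun x _ => (hdiff x).hasDerivAt.hasDerivWithinAt) hinj.injOn h
  rw [Set.image_univ, setLIntegral_univ] at key
  have hsupp : Function.support h ⊆ Set.range γ := fun s hs => by
    by_contra hs'
    exact hs (hh s hs')
  rw [← setLIntegral_eq_of_support_subset hsupp, key]
  simp only [abs_of_nonneg hmono.deriv_nonneg]

theorem memLp_warpTranspose (hdiff : Differentiable ℝ γ) (hmono : Monotone γ)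
    (hinj : Function.Injective γ) {φ : ℝ → 𝕜} (hφm : Measurable φ) (hφ : MemLp φ 2 volume) :
    MemLp (warpTranspose γ φ) 2 volume := by
  refine ⟨(measurable_warpTranspose hdiff.continuous hinj hφm).aestronglyMeasurable, ?_⟩
  have hφ' := hφ.2
  rw [eLpNorm_lt_top_iff_lintegral_rpow_enorm_lt_top (by simp) (by simp)] at hφ' ⊢
  refine lt_of_le_of_lt ?_ hφ'
  rw [lintegral_eq_lintegral_deriv_mul_comp hdiff hmono hinj
    (fun s hs => by simp [warpTranspose_of_notMem_range hs])]
  refine lintegral_mono fun t => ?_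
  rw [warpTranspose_apply hinj]
  rcases (hmono.deriv_nonneg (x := t)).eq_or_lt with h0 | hp
  · simp [← h0]
  · have hne : ENNReal.ofReal (deriv γ t) ≠ 0 := by simpa using hp
    rw [div_eq_mul_inv, enorm_mul, ENNReal.mul_rpow_of_nonneg _ _ (by simp), ← mul_assoc,
      mul_comm _ (‖φ t‖ₑ ^ _), mul_assoc]
    refine mul_le_of_le_one_right' ?_
    have : ‖(((√(deriv γ t) : ℝ) : 𝕜))⁻¹‖ₑ ^ (ENNReal.toReal 2)
        = (ENNReal.ofReal (deriv γ t))⁻¹ := by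
      rw [← ofReal_norm, norm_inv, RCLike.norm_ofReal, abs_of_nonneg (Real.sqrt_nonneg _),
        ENNReal.ofReal_rpow_of_nonneg (by positivity) (by simp), ← ENNReal.ofReal_inv_of_pos hp]
      congr 1
      simp [Real.sq_sqrt hp.le]
    rw [this]
    exact ENNReal.mul_inv_le_one _

theorem isWarpTranspose_warpTranspose (hdiff : Differentiable ℝ γ) (hmono : Monotone γ)
    (hinj : Function.Injective γ) (φ : 𝓢(ℝ, 𝕜)) :
    IsWarpTranspose γ φ (warpTranspose γ φ) := by
  refine ⟨memLp_warpTranspose hdiff hmono hinj φ.continuous.measurable (φ.memLp 2 volume),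
    fun x => ?_⟩
  rw [integral_eq_integral_deriv_smul_comp (h := fun s => x s * warpTranspose γ φ s)
    hdiff hmono hinj
    (fun s hs => by simp [warpTranspose_of_notMem_range hs])]
  refine integral_congr_ae (ae_of_all _ fun t => ?_)
  dsimp only
  rw [warpTranspose_apply hinj, timeWarp, RCLike.real_smul_eq_coe_mul]
  rcases (hmono.deriv_nonneg (x := t)).eq_or_lt with h0 | hp
  · simp [← h0]
  · have hne : ((√(deriv γ t) : ℝ) : 𝕜) ≠ 0 := by
      simpa using (Real.sqrt_pos.2 hp).ne'
    have hsq : ((deriv γ t : ℝ) : 𝕜) = ((√(deriv γ t) : ℝ) : 𝕜) * ((√(deriv γ t) : ℝ) : 𝕜) := by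
      rw [← RCLike.ofReal_mul, Real.mul_self_sqrt hp.le]
    rw [hsq]
    field_simp

/-- The transpose is determined almost everywhere, as its integrals against test functions are. -/
theorem IsWarpTranspose.ae_eq {φ : 𝓢(ℝ, 𝕜)} {g g' : ℝ → 𝕜} (hg : IsWarpTranspose γ φ g)
    (hg' : IsWarpTranspose γ φ g') : g =ᵐ[volume] g' := by
  refine ae_eq_of_integral_contDiff_smul_eq (hg.1.locallyIntegrable (by norm_num))
    (hg'.1.locallyIntegrable (by norm_num)) fun x hx hxc => ?_
  have hx₁ : HasCompactSupport fun t => (x t : 𝕜) :=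
    hxc.comp_left (g := fun r : ℝ => (r : 𝕜)) (by simp)
  have hx₂ : ContDiff ℝ ((⊤ : ℕ∞) : WithTop ℕ∞) fun t => (x t : 𝕜) :=
    (RCLike.ofRealCLM (K := 𝕜)).contDiff.comp hx
  have h := (hg.2 (hx₁.toSchwartzMap hx₂)).symm.trans (hg'.2 (hx₁.toSchwartzMap hx₂))
  simpa [RCLike.real_smul_eq_coe_mul] using h

/-- `D_γᵀ` preserves the `L²` norm and the bilinear integral `∫ f²`, hence the quadratic form.
Without `γ' > 0` almost everywhere the contribution of `φ` on the set `γ' = 0` would be lost. -/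
theorem noiseForm_warpTranspose (hdiff : Differentiable ℝ γ) (hmono : Monotone γ)
    (hinj : Function.Injective γ) (hpos : ∀ᵐ t : ℝ, 0 < deriv γ t) (a : ℝ) (ρ : 𝕜) (φ : ℝ → 𝕜) :
    noiseForm a ρ (warpTranspose γ φ) = noiseForm a ρ φ := by
  have h₁ : ∫ t, ‖warpTranspose γ φ t‖ ^ 2 = ∫ t, ‖φ t‖ ^ 2 := by
    rw [integral_eq_integral_deriv_smul_comp hdiff hmono hinj
      (fun s hs => by simp [warpTranspose_of_notMem_range hs])]
    refine integral_congr_ae ?_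
    filter_upwards [hpos] with t ht
    rw [warpTranspose_apply hinj, norm_div, RCLike.norm_ofReal, div_pow, sq_abs,
      Real.sq_sqrt ht.le, smul_eq_mul, mul_div_cancel₀ _ ht.ne']
  have h₂ : ∫ t, warpTranspose γ φ t ^ 2 = ∫ t, φ t ^ 2 := by
    rw [integral_eq_integral_deriv_smul_comp hdiff hmono hinj
      (fun s hs => by simp [warpTranspose_of_notMem_range hs])]
    refine integral_congr_ae ?_
    filter_upwards [hpos] with t ht
    have hne : ((deriv γ t : ℝ) : 𝕜) ≠ 0 := by simpa using ht.ne'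
    rw [warpTranspose_apply hinj, div_pow, ← RCLike.ofReal_pow, Real.sq_sqrt ht.le,
      RCLike.real_smul_eq_coe_mul, mul_div_cancel₀ _ hne]
  rw [noiseForm, noiseForm, h₁, h₂]

end Warp

/-! ### Warped white noise -/

section WarpedNoise

variable {Ω : Type*} [MeasurableSpace Ω] {P : Measure Ω} {𝕜 : Type*} [RCLike 𝕜]
  {γ : ℝ → ℝ} {N M : 𝓢(ℝ, 𝕜) → Ω → 𝕜} {a : ℝ} {ρ : 𝕜}

theorem IsGaussianFunctional.exists_isWarpedProcess [IsProbabilityMeasure P]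
    (hN : IsGaussianFunctional P N a ρ) (hdiff : Differentiable ℝ γ) (hmono : Monotone γ)
    (hinj : Function.Injective γ) : ∃ M : 𝓢(ℝ, 𝕜) → Ω → 𝕜, IsWarpedProcess P γ N M := by
  have h := fun φ : 𝓢(ℝ, 𝕜) =>
    hN.exists_isL2Pairing (isWarpTranspose_warpTranspose hdiff hmono hinj φ).1
  choose M hM using h
  exact ⟨M, fun φ => ⟨_, isWarpTranspose_warpTranspose hdiff hmono hinj φ, hM φ⟩⟩

theorem IsGaussianFunctional.of_isWarpedProcess [IsProbabilityMeasure P]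
    (hN : IsGaussianFunctional P N a ρ) (hdiff : Differentiable ℝ γ) (hmono : Monotone γ)
    (hinj : Function.Injective γ) (hpos : ∀ᵐ t : ℝ, 0 < deriv γ t) (hM : IsWarpedProcess P γ N M) :
    IsGaussianFunctional P M a ρ := by
  have hmem : ∀ φ : 𝓢(ℝ, 𝕜), MemLp (warpTranspose γ φ) 2 volume := fun φ =>
    (isWarpTranspose_warpTranspose hdiff hmono hinj φ).1
  have hpair : ∀ φ : 𝓢(ℝ, 𝕜), IsL2Pairing P N (warpTranspose γ φ) (M φ) := fun φ => by
    obtain ⟨g, hg, hgM⟩ := hM φ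
    exact hgM.congr_ae (hg.ae_eq (isWarpTranspose_warpTranspose hdiff hmono hinj φ))
  have hlin := hN.toIsRandomFunctional
  refine ⟨⟨fun φ => (hpair φ).aemeasurable hlin (hmem φ), fun φ ψ => ?_, fun c φ => ?_⟩,
    fun φ => ?_⟩
  · refine IsL2Pairing.add hlin (hmem φ) (hmem ψ) (hpair φ) (hpair ψ) ?_
    rw [← warpTranspose_add hinj]
    exact hpair (φ + ψ)
  · refine IsL2Pairing.smul hlin (hmem φ) c (hpair φ) ?_
    rw [← warpTranspose_smul hinj]
    exact hpair (c • φ)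
  · rw [hN.integral_exp_of_isL2Pairing (hmem φ) (hpair φ),
      noiseForm_warpTranspose hdiff hmono hinj hpos]

theorem isRealGaussianWhiteNoise_iff {N : 𝓢(ℝ, ℝ) → Ω → ℝ} {σ : ℝ} :
    IsRealGaussianWhiteNoise P N σ ↔ IsGaussianFunctional P N (σ ^ 2 / 2) 0 := by
  have h : ∀ φ : 𝓢(ℝ, ℝ), -noiseForm (σ ^ 2 / 2) (0 : ℝ) φ = -(σ ^ 2 * ∫ t, φ t ^ 2) / 2 := by
    intro φ
    simp [noiseForm]
    ring
  refine ⟨fun hN => ⟨hN.toIsRandomFunctional, fun φ => ?_⟩,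
    fun hN => ⟨hN.toIsRandomFunctional, fun φ => ?_⟩⟩
  · rw [h]; exact hN.charFunctional φ
  · rw [← h]; exact hN.charFunctional φ

theorem isComplexGaussianWhiteNoise_iff {N : 𝓢(ℝ, ℂ) → Ω → ℂ} {σ : ℝ} {ρ : ℂ} :
    IsComplexGaussianWhiteNoise P N σ ρ ↔ IsGaussianFunctional P N (σ ^ 2 / 4) (ρ / 4) := by
  have h : ∀ φ : 𝓢(ℝ, ℂ), -noiseForm (σ ^ 2 / 4) (ρ / 4) φ
      = -(σ ^ 2 * (∫ t, ‖φ t‖ ^ 2) + (ρ * ∫ t, φ t ^ 2).re) / 4 := by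
    intro φ
    have : ρ / 4 * ∫ t, φ t ^ 2 = (ρ * ∫ t, φ t ^ 2) / ((4 : ℝ) : ℂ) := by push_cast; ring
    rw [noiseForm, this, RCLike.re_eq_complex_re, Complex.div_ofReal_re]
    ring
  refine ⟨fun hN => ⟨hN.toIsRandomFunctional, fun φ => ?_⟩,
    fun hN => ⟨hN.toIsRandomFunctional, fun φ => ?_⟩⟩
  · rw [h]; exact hN.charFunctional φ
  · rw [← h]; exact hN.charFunctional φ

end WarpedNoise

theorem mainTheorem5 {Ω : Type*} [MeasurableSpace Ω] (P : Measure Ω) [IsProbabilityMeasure P]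
    (γ : ℝ → ℝ) (hγ : ContDiff ℝ 2 γ) (hmono : Monotone γ) (hpos : ∀ᵐ t : ℝ, 0 < deriv γ t)
    (σ : ℝ) :
    (∀ N : 𝓢(ℝ, ℝ) → Ω → ℝ, IsRealGaussianWhiteNoise P N σ →
      (∃ M : 𝓢(ℝ, ℝ) → Ω → ℝ, IsWarpedProcess P γ N M) ∧
      ∀ M : 𝓢(ℝ, ℝ) → Ω → ℝ, IsWarpedProcess P γ N M → IsRealGaussianWhiteNoise P M σ) ∧
    (∀ (ρ : ℂ) (N : 𝓢(ℝ, ℂ) → Ω → ℂ), IsComplexGaussianWhiteNoise P N σ ρ →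
      (∃ M : 𝓢(ℝ, ℂ) → Ω → ℂ, IsWarpedProcess P γ N M) ∧
      ∀ M : 𝓢(ℝ, ℂ) → Ω → ℂ, IsWarpedProcess P γ N M →
        IsComplexGaussianWhiteNoise P M σ ρ) := by
  have hdiff : Differentiable ℝ γ := hγ.differentiable (by norm_num)
  have hinj := (strictMono_of_monotone_of_ae_deriv_pos hmono hpos).injective
  refine ⟨fun N hN => ?_, fun ρ N hN => ?_⟩
  · have hN' := isRealGaussianWhiteNoise_iff.1 hN
    exact ⟨hN'.exists_isWarpedProcess hdiff hmono hinj, fun M hM =>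
      isRealGaussianWhiteNoise_iff.2 (hN'.of_isWarpedProcess hdiff hmono hinj hpos hM)⟩
  · have hN' := isComplexGaussianWhiteNoise_iff.1 hN
    exact ⟨hN'.exists_isWarpedProcess hdiff hmono hinj, fun M hM =>
      isComplexGaussianWhiteNoise_iff.2 (hN'.of_isWarpedProcess hdiff hmono hinj hpos hM)⟩
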